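/- A graph is a structure $\mathsf G=\langle V;\sim\rangle$ with ${\sim}\subseteq V\times V$ an arbitrary binary relation (so graphs are directed, loops are allowed, and $V$ may be empty). A universal Horn (uH) sentence is a universally quantified formula of the form $(\Phi_1\,\&\cdots\&\,\Phi_n)\rightarrow\Phi_0$ or $\neg\Phi_0\vee\cdots\vee\neg\Phi_n$ with $n\ge 0$, where each $\Phi_i$ is atomic, i.e. of the form $x\sim y$ or $x\approx y$. A uH class is a class of graphs that contains the empty graph and is closed under isomorphic copies, induced subgraphs, direct products of nonempty families, and ultraproducts; the uH class of a class $K$ of graphs is the least uH class containing $K$. The adjacency semigroup $\mathrm A(\mathsf G)$ is the set $(V\times V)\cup\{0\}$ with the multiplication $(x,y)(z,t)=(x,t)$ if $y\sim z$ and $(x,y)(z,t)=0$ if $y\not\sim z$, $a0=0a=0$, and with the unary operation $(x,y)'=(y,x)$, $0'=0$; put $\mathrm A(K)=\{\mathrm A(\mathsf G)\mid \mathsf G\in K\}$. A variety of unary semigroups (semigroups with an additional unary operation) is a class of them closed under homomorphic images, subalgebras and direct products; identities and varieties below are those of unary semigroups. Let $K$ be any class of graphs. 1. If $K$ has no finite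 basis of uH sentences (no finite set of uH sentences has the same models as the set of all uH sentences holding in $K$), then $\mathrm A(K)$ has no finite basis of identities (no finite set of identities has the same models, among unary semigroups, as the set of all identities holding in $\mathrm A(K)$). 2. If the uH class of $K$ contains infinitely many uH classes, then the variety generated by $\mathrm A(K)$ has infinitely many subvarieties. 3. If the uH class of $K$ contains uncountably many uH classes, then the variety generated by $\mathrm A(K)$ has uncountably many subvarieties. -/

import Mathlib

universe u

/-! ## Graphs -/

/-- A graph: a set of vertices with an arbitrary binary relation on it (loops are allowed, the
relation need not be symmetric, and the vertex set may be empty). -/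
structure DirGraph : Type (u + 1) where
  V : Type u
  graph : Digraph V

namespace DirGraph

/-- The edge relation. -/
def Adj (G : DirGraph.{u}) (a b : G.V) : Prop := G.graph.Adj a b

/-- The direct product of a family of graphs. -/
def prod {I : Type u} (H : I → DirGraph.{u}) : DirGraph.{u} where
  V := ∀ i, (H i).V
  graph := { Adj := fun a b => ∀ i, (H i).Adj (a i) (b i) }

/-- The ultraproduct of a family of graphs: vertices are the classes of elements of the product
that agree on a set in the ultrafilter, and the class of `f` is joined to the class of `g` iff
`f i ∼ g i` on a set in the ultrafilter. -/
def ultraproduct {I : Type u} (U : Ultrafilter I) (H : I → DirGraph.{u}) : DirGraph.{u} where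
  V := (U : Filter I).Product fun i => (H i).V
  graph :=
    { Adj := fun a b => ∃ f g : ∀ i, (H i).V,
        a = Quotient.mk _ f ∧ b = Quotient.mk _ g ∧ ∀ᶠ i in (U : Filter I), (H i).Adj (f i) (g i) }

end DirGraph

/-- Universal Horn classes: classes of graphs closed under isomorphic copies and induced subgraphs
(`G` is isomorphic to an induced subgraph of `H` iff there is an embedding of relations), under
nonempty direct products, and under ultraproducts. Every universal Horn class contains the empty
graph, that is, the empty class is not one. -/
structure IsUHClass (L : Set DirGraph.{u}) : Prop where
  nonempty : L.Nonempty
  induced : ∀ G H : DirGraph.{u}, H ∈ L → Nonempty (G.Adj ↪r H.Adj) → G ∈ L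
  prod : ∀ (I : Type u) [Nonempty I] (H : I → DirGraph.{u}),
    (∀ i, H i ∈ L) → DirGraph.prod H ∈ L
  ultraproduct : ∀ (I : Type u) (U : Ultrafilter I) (H : I → DirGraph.{u}),
    (∀ i, H i ∈ L) → DirGraph.ultraproduct U H ∈ L

/-- The universal Horn class generated by `K`: the least one containing `K`. -/
def uhClassGenerated (K : Set DirGraph.{u}) : Set DirGraph.{u} :=
  ⋂₀ {L | IsUHClass L ∧ K ⊆ L}

/-- The sub-universal-Horn-classes of `L`. -/
def subUHClasses (L : Set DirGraph.{u}) : Set (Set DirGraph.{u}) :=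
  {M | IsUHClass M ∧ M ⊆ L}

/-! ## Universal Horn sentences -/

/-- Atomic formulas `x ∼ y` and `x ≈ y` in the language of graphs; variables are indexed by `ℕ`. -/
inductive GraphAtom : Type
  | adj (x y : ℕ) : GraphAtom
  | eq (x y : ℕ) : GraphAtom

/-- Truth of an atomic formula under an assignment. -/
def GraphAtom.Realize {G : DirGraph.{u}} (v : ℕ → G.V) : GraphAtom → Prop
  | .adj x y => G.Adj (v x) (v y)
  | .eq x y => v x = v y

/-- Universal Horn sentences. `horn [Φ₁, …, Φₙ] Φ₀` is the universally quantified
`Φ₁ & … & Φₙ → Φ₀` (with `n = 0` allowed), and `neg Φ₀ [Φ₁, …, Φₙ]` is the universally quantified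
`¬Φ₀ ∨ ¬Φ₁ ∨ … ∨ ¬Φₙ`. -/
inductive UHSentence : Type
  | horn (premises : List GraphAtom) (conclusion : GraphAtom) : UHSentence
  | neg (first : GraphAtom) (rest : List GraphAtom) : UHSentence

/-- `G ⊨ Γ`. -/
def DirGraph.Satisfies (G : DirGraph.{u}) : UHSentence → Prop
  | .horn premises conclusion =>
      ∀ v : ℕ → G.V, (∀ Φ ∈ premises, Φ.Realize v) → conclusion.Realize v
  | .neg first rest => ∀ v : ℕ → G.V, ∃ Φ ∈ first :: rest, ¬ Φ.Realize v

/-- `B` is a basis of the universal Horn sentences of `K`: its models are exactly the models of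
all universal Horn sentences that hold in every member of `K`. -/
def IsUHBasis (K : Set DirGraph.{u}) (B : Set UHSentence) : Prop :=
  ∀ G : DirGraph.{u}, (∀ Γ ∈ B, G.Satisfies Γ) ↔
    ∀ Γ : UHSentence, (∀ H ∈ K, H.Satisfies Γ) → G.Satisfies Γ

/-- `K` has a finite basis of universal Horn sentences. -/
def HasFiniteUHBasis (K : Set DirGraph.{u}) : Prop :=
  ∃ B : Set UHSentence, B.Finite ∧ IsUHBasis K B

/-! ## Unary semigroups -/

/-- A unary semigroup: a (nonempty) semigroup with an additional unary operation. -/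
structure UnarySemigroup : Type (u + 1) where
  carrier : Type u
  [semigroup : Semigroup carrier]
  [nonempty : Nonempty carrier]
  rev : carrier → carrier

namespace UnarySemigroup

instance (S : UnarySemigroup.{u}) : Semigroup S.carrier := S.semigroup
instance (S : UnarySemigroup.{u}) : Nonempty S.carrier := S.nonempty

/-- Homomorphisms of unary semigroups. -/
structure IsHom (S T : UnarySemigroup.{u}) (f : S.carrier → T.carrier) : Prop where
  map_mul : ∀ a b, f (a * b) = f a * f b
  map_rev : ∀ a, f (S.rev a) = T.rev (f a)

/-- The direct product of a family of unary semigroups. -/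
def prod {I : Type u} (S : I → UnarySemigroup.{u}) : UnarySemigroup.{u} where
  carrier := ∀ i, (S i).carrier
  rev := fun a i => (S i).rev (a i)

end UnarySemigroup

/-- Varieties of unary semigroups: classes closed under homomorphic images, under (isomorphic
copies of) subalgebras, and under direct products (including the empty product, which is the
one-element algebra). -/
structure IsUSVariety (W : Set UnarySemigroup.{u}) : Prop where
  image : ∀ S T : UnarySemigroup.{u}, S ∈ W →
    ∀ f : S.carrier → T.carrier, S.IsHom T f → Function.Surjective f → T ∈ W
  sub : ∀ S T : UnarySemigroup.{u}, T ∈ W →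
    ∀ f : S.carrier → T.carrier, S.IsHom T f → Function.Injective f → S ∈ W
  prod : ∀ (I : Type u) (S : I → UnarySemigroup.{u}),
    (∀ i, S i ∈ W) → UnarySemigroup.prod S ∈ W

/-- The variety generated by a class of unary semigroups: the least one containing it. -/
def varietyGenerated (C : Set UnarySemigroup.{u}) : Set UnarySemigroup.{u} :=
  ⋂₀ {W | IsUSVariety W ∧ C ⊆ W}

/-- The subvarieties of `W`. -/
def subvarieties (W : Set UnarySemigroup.{u}) : Set (Set UnarySemigroup.{u}) :=
  {X | IsUSVariety X ∧ X ⊆ W}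

/-- Terms in the language of unary semigroups; variables are indexed by `ℕ`. -/
inductive USTerm : Type
  | var (x : ℕ) : USTerm
  | mul (s t : USTerm) : USTerm
  | rev (s : USTerm) : USTerm

/-- The value of a term under an assignment. -/
def USTerm.eval (S : UnarySemigroup.{u}) (v : ℕ → S.carrier) : USTerm → S.carrier
  | .var x => v x
  | .mul s t => s.eval S v * t.eval S v
  | .rev s => S.rev (s.eval S v)

/-- `S ⊨ p.1 ≈ p.2`; an identity is a pair of terms. -/
def UnarySemigroup.SatisfiesIdentity (S : UnarySemigroup.{u}) (p : USTerm × USTerm) : Prop :=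
  ∀ v : ℕ → S.carrier, p.1.eval S v = p.2.eval S v

/-- `B` is an identity basis of the class `C`: the unary semigroups satisfying `B` are exactly
those satisfying all identities that hold in every member of `C`. -/
def IsIdentityBasis (C : Set UnarySemigroup.{u}) (B : Set (USTerm × USTerm)) : Prop :=
  ∀ S : UnarySemigroup.{u}, (∀ p ∈ B, S.SatisfiesIdentity p) ↔
    ∀ p : USTerm × USTerm, (∀ T ∈ C, T.SatisfiesIdentity p) → S.SatisfiesIdentity p

/-- `C` has a finite identity basis. -/
def HasFiniteIdentityBasis (C : Set UnarySemigroup.{u}) : Prop :=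
  ∃ B : Set (USTerm × USTerm), B.Finite ∧ IsIdentityBasis C B

/-! ## Adjacency semigroups -/

/-- The underlying set `(V × V) ∪ {0}` of the adjacency semigroup. -/
inductive AdjElem (V : Type u) : Type u
  | zero : AdjElem V
  | pair (x y : V) : AdjElem V

open Classical in
/-- `(x, y)(z, t)` is `(x, t)` if `y ∼ z` and `0` otherwise; `a0 = 0a = 0`. -/
noncomputable def AdjElem.mul (G : DirGraph.{u}) : AdjElem G.V → AdjElem G.V → AdjElem G.V
  | .pair x y, .pair z t => if G.Adj y z then .pair x t else .zero
  | _, _ => .zero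

/-- Reversion: `(x, y)' = (y, x)` and `0' = 0`. -/
def AdjElem.rev {V : Type u} : AdjElem V → AdjElem V
  | .zero => .zero
  | .pair x y => .pair y x

theorem AdjElem.mul_assoc (G : DirGraph.{u}) (a b c : AdjElem G.V) :
    AdjElem.mul G (AdjElem.mul G a b) c = AdjElem.mul G a (AdjElem.mul G b c) := by
  classical
  rcases a with _ | ⟨a₁, a₂⟩ <;> rcases b with _ | ⟨b₁, b₂⟩ <;> rcases c with _ | ⟨c₁, c₂⟩ <;>
    simp only [AdjElem.mul] <;> split_ifs <;> simp_all

/-- The adjacency semigroup `A(G)` of a graph `G`, with reversion. -/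
noncomputable def adjacencySemigroup (G : DirGraph.{u}) : UnarySemigroup.{u} where
  carrier := AdjElem G.V
  semigroup := { mul := AdjElem.mul G, mul_assoc := AdjElem.mul_assoc G }
  nonempty := ⟨AdjElem.zero⟩
  rev := AdjElem.rev

/-- The class `A(K)` of the adjacency semigroups of the members of `K`. -/
def adjacencyClass (K : Set DirGraph.{u}) : Set UnarySemigroup.{u} :=
  adjacencySemigroup '' K

/-!
Assigning nonzero elements of `A(G)` to variables amounts to naming two vertices of `G` by each
variable. The value of a term is then nonzero iff certain edges between the named vertices are
present, and in this case it consists of two of the named vertices. Hence an identity holds in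
`A(G)` iff `G` satisfies certain finitely many universal Horn sentences. Conversely, the premises of
a universal Horn sentence can be encoded in a term, and its conclusion by an identity saying that
every nonzero value `(x, y)` of the term satisfies `x ∼ y` or `x ≈ y`, or that there is no such
value. This turns finite identity bases of `A(K)` into finite bases of universal Horn sentences
of `K`.

As universal Horn classes are axiomatized by universal Horn sentences, and as the graphs `G` with
`A(G)` in a given variety form a universal Horn class, `A(G)` belongs to the variety generated by
`A(K)` iff `G` belongs to the universal Horn class generated by `K`. Therefore a universal Horn
class `M` can be recovered from the variety generated by `A(M)`.
-/

/-! ## Terms over adjacency semigroups -/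

namespace AdjElem

theorem ext_pair {V : Type u} {a b : AdjElem V} (h : ∀ x y, a = pair x y ↔ b = pair x y) :
    a = b := by
  cases a with
  | zero => cases b with
    | zero => rfl
    | pair x y => exact (h x y).2 rfl
  | pair x y => exact ((h x y).1 rfl).symm

theorem rev_eq_pair_iff {V : Type u} {a : AdjElem V} {x y : V} :
    a.rev = pair x y ↔ a = pair y x := by
  cases a <;> simp [rev, and_comm]

theorem mul_eq_pair_iff {G : DirGraph.{u}} {a b : AdjElem G.V} {x t : G.V} :
    mul G a b = pair x t ↔ ∃ y z, a = pair x y ∧ b = pair z t ∧ G.Adj y z := by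
  rcases a with _ | ⟨x', y⟩ <;> rcases b with _ | ⟨z, t'⟩ <;>
    simp [mul, ite_eq_iff, and_comm, and_assoc]

end AdjElem

section

variable {G : DirGraph.{u}}

/-- All edges in the list `E` are present under the assignment `g` of vertices to variables. -/
def EdgesHold (G : DirGraph.{u}) (g : ℕ → G.V) (E : List (ℕ × ℕ)) : Prop :=
  ∀ e ∈ E, G.Adj (g e.1) (g e.2)

theorem edgesHold_nil {g : ℕ → G.V} : EdgesHold G g [] := by
  simp [EdgesHold]

theorem edgesHold_cons {g : ℕ → G.V} {e : ℕ × ℕ} {E : List (ℕ × ℕ)} :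
    EdgesHold G g (e :: E) ↔ G.Adj (g e.1) (g e.2) ∧ EdgesHold G g E :=
  List.forall_mem_cons

theorem edgesHold_append {g : ℕ → G.V} {E F : List (ℕ × ℕ)} :
    EdgesHold G g (E ++ F) ↔ EdgesHold G g E ∧ EdgesHold G g F :=
  List.forall_mem_append

namespace USTerm

/-- The set of variables occurring in a term. -/
def vars : USTerm → Finset ℕ
  | .var x => {x}
  | .mul s t => s.vars ∪ t.vars
  | .rev s => s.vars

/-- The vertex variables naming the left and the right vertex of a nonzero value of a term in an
adjacency semigroup. The two vertices of the value of `x` are named by `2 * x` and `2 * x + 1`. -/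
def ends : USTerm → ℕ × ℕ
  | .var x => (2 * x, 2 * x + 1)
  | .mul s t => (s.ends.1, t.ends.2)
  | .rev s => s.ends.swap

/-- The edges between vertex variables, numbered as in `USTerm.ends`, that have to be present for
the value of a term in an adjacency semigroup to be nonzero. -/
def edges : USTerm → List (ℕ × ℕ)
  | .var _ => []
  | .mul s t => (s.ends.2, t.ends.1) :: (s.edges ++ t.edges)
  | .rev s => s.edges

theorem eval_congr {S : UnarySemigroup.{u}} {v w : ℕ → S.carrier} {t : USTerm}
    (h : ∀ x ∈ t.vars, v x = w x) : t.eval S v = t.eval S w := by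
  induction t with
  | var x => exact h x (Finset.mem_singleton_self x)
  | rev s ih => exact congrArg S.rev (ih h)
  | mul s t ihs iht =>
    exact congrArg₂ (· * ·) (ihs fun x hx => h x (Finset.mem_union_left _ hx))
      (iht fun x hx => h x (Finset.mem_union_right _ hx))

end USTerm

/-- The value of a term in `A(G)`, as an element of `AdjElem G.V` rather than of the carrier of the
bundled semigroup. -/
noncomputable def adjEval (G : DirGraph.{u}) (v : ℕ → AdjElem G.V) (t : USTerm) : AdjElem G.V :=
  t.eval (adjacencySemigroup G) v

theorem adjEval_var {v : ℕ → AdjElem G.V} {x : ℕ} :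
    adjEval G v (.var x) = v x := rfl

theorem adjEval_mul {v : ℕ → AdjElem G.V} {s t : USTerm} :
    adjEval G v (.mul s t) = AdjElem.mul G (adjEval G v s) (adjEval G v t) := rfl

theorem adjEval_rev {v : ℕ → AdjElem G.V} {s : USTerm} :
    adjEval G v (.rev s) = (adjEval G v s).rev := rfl

/-- The assignment of nonzero elements of an adjacency semigroup given by an assignment of vertices
to vertex variables, numbered as in `USTerm.ends`. -/
def pairValuation {V : Type u} (g : ℕ → V) (n : ℕ) : AdjElem V :=
  .pair (g (2 * n)) (g (2 * n + 1))

theorem adjEval_pairValuation_eq_pair_iff {g : ℕ → G.V} {t : USTerm}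
    {x y : G.V} : adjEval G (pairValuation g) t = .pair x y ↔
      EdgesHold G g t.edges ∧ g t.ends.1 = x ∧ g t.ends.2 = y := by
  induction t generalizing x y with
  | var n => simp [adjEval_var, pairValuation, USTerm.edges, USTerm.ends, edgesHold_nil]
  | rev s ih =>
    simp only [adjEval_rev, AdjElem.rev_eq_pair_iff, ih, USTerm.edges, USTerm.ends,
      Prod.fst_swap, Prod.snd_swap, and_comm]
  | mul s t ihs iht =>
    simp only [adjEval_mul, AdjElem.mul_eq_pair_iff, ihs, iht, USTerm.edges, USTerm.ends,
      edgesHold_cons, edgesHold_append]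
    constructor
    · rintro ⟨_, _, ⟨hs, rfl, rfl⟩, ⟨ht, rfl, rfl⟩, h⟩
      exact ⟨⟨h, hs, ht⟩, rfl, rfl⟩
    · rintro ⟨⟨h, hs, ht⟩, rfl, rfl⟩
      exact ⟨_, _, ⟨hs, rfl, rfl⟩, ⟨ht, rfl, rfl⟩, h⟩

theorem exists_eq_pair_of_adjEval_eq_pair {v : ℕ → AdjElem G.V} {t : USTerm}
    {x y : G.V} (h : adjEval G v t = .pair x y) {n : ℕ} (hn : n ∈ t.vars) :
    ∃ a b, v n = .pair a b := by
  induction t generalizing x y with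
  | var m => exact Finset.mem_singleton.1 hn ▸ ⟨x, y, h⟩
  | rev s ih => exact ih (AdjElem.rev_eq_pair_iff.1 h) hn
  | mul s t ihs iht =>
    obtain ⟨_, _, hs, ht, -⟩ := AdjElem.mul_eq_pair_iff.1 h
    exact (Finset.mem_union.1 hn).elim (ihs hs) (iht ht)

theorem exists_interleave {V : Type u} (l r : ℕ → V) :
    ∃ g : ℕ → V, (∀ n, g (2 * n) = l n) ∧ ∀ n, g (2 * n + 1) = r n :=
  ⟨Sum.elim l r ∘ Equiv.natSumNatEquivNat.symm,
    fun n => congrArg (Sum.elim l r) (Equiv.natSumNatEquivNat.symm_apply_apply (.inl n)),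
    fun n => congrArg (Sum.elim l r) (Equiv.natSumNatEquivNat.symm_apply_apply (.inr n))⟩

theorem exists_pairValuation_of_adjEval_eq_pair {v : ℕ → AdjElem G.V}
    {t : USTerm} {x y : G.V} (h : adjEval G v t = .pair x y) :
    ∃ g : ℕ → G.V, ∀ n ∈ t.vars, v n = pairValuation g n := by
  have hv : ∀ n, ∃ a b, n ∈ t.vars → v n = .pair a b := fun n => by
    by_cases hn : n ∈ t.vars
    · obtain ⟨a, b, hab⟩ := exists_eq_pair_of_adjEval_eq_pair h hn
      exact ⟨a, b, fun _ => hab⟩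
    · exact ⟨x, x, fun hn' => absurd hn' hn⟩
  choose l r hlr using hv
  obtain ⟨g, hl, hr⟩ := exists_interleave l r
  exact ⟨g, fun n hn => by rw [pairValuation, hl, hr, hlr n hn]⟩

theorem exists_adjEval_eq_pair_iff {t : USTerm} {x y : G.V} :
    (∃ v, adjEval G v t = .pair x y) ↔
      ∃ g : ℕ → G.V, EdgesHold G g t.edges ∧ g t.ends.1 = x ∧ g t.ends.2 = y := by
  constructor
  · rintro ⟨v, hv⟩
    obtain ⟨g, hg⟩ := exists_pairValuation_of_adjEval_eq_pair hv
    exact ⟨g, adjEval_pairValuation_eq_pair_iff.1 ((USTerm.eval_congr hg).symm.trans hv)⟩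
  · rintro ⟨g, hg⟩
    exact ⟨pairValuation g, adjEval_pairValuation_eq_pair_iff.2 hg⟩

end

/-! ## Normal forms of universal Horn sentences -/

/-- The possible right-hand sides of a universal Horn sentence, with `falsum` for the sentences
without a positive atomic formula. -/
inductive HornHead : Type
  | adj : HornHead
  | eq : HornHead
  | falsum : HornHead

/-- The relation on the vertices of a graph that a right-hand side stands for. -/
def HornHead.Holds (G : DirGraph.{u}) : HornHead → G.V → G.V → Prop
  | .adj => G.Adj
  | .eq => Eq
  | .falsum => fun _ _ => False

/-- The universal Horn sentence with the edges `E` as premises and the given right-hand side for the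
variables `x` and `y`. The formula `0 ≈ 0` only serves to make the disjunction nonempty. -/
def hornClause (E : List (ℕ × ℕ)) (x y : ℕ) : HornHead → UHSentence
  | .adj => .horn (E.map fun e => .adj e.1 e.2) (.adj x y)
  | .eq => .horn (E.map fun e => .adj e.1 e.2) (.eq x y)
  | .falsum => .neg (.eq 0 0) (E.map fun e => .adj e.1 e.2)

theorem satisfies_neg_iff {G : DirGraph.{u}} {Φ : GraphAtom} {P : List GraphAtom} :
    G.Satisfies (.neg Φ P) ↔ ∀ v : ℕ → G.V, ¬ ∀ Ψ ∈ Φ :: P, Ψ.Realize v := by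
  simp only [DirGraph.Satisfies, not_forall, exists_prop]

theorem satisfies_hornClause_iff {G : DirGraph.{u}} {E : List (ℕ × ℕ)} {x y : ℕ}
    {head : HornHead} : G.Satisfies (hornClause E x y head) ↔
      ∀ v : ℕ → G.V, EdgesHold G v E → head.Holds G (v x) (v y) := by
  have hE (v : ℕ → G.V) :
      (∀ Φ ∈ E.map fun e => GraphAtom.adj e.1 e.2, Φ.Realize v) ↔ EdgesHold G v E :=
    List.forall_mem_map
  cases head with
  | falsum =>
    simp only [hornClause, satisfies_neg_iff, List.forall_mem_cons, hE]
    exact forall_congr' fun v => not_congr (and_iff_right rfl)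
  | _ => exact forall_congr' fun v => imp_congr_left (hE v)

theorem exists_edgesHold_comp_iff (P : List GraphAtom) :
    ∃ (q : ℕ → ℕ) (E : List (ℕ × ℕ)), ∀ (G : DirGraph.{u}) (v : ℕ → G.V),
      (∀ Φ ∈ P, Φ.Realize v) ↔ ∃ w, EdgesHold G w E ∧ w ∘ q = v := by
  let r := Relation.EqvGen.setoid fun x y => GraphAtom.eq x y ∈ P
  let q : ℕ → ℕ := fun n => (Quotient.mk r n).out
  let edge : GraphAtom → Option (ℕ × ℕ)
    | .adj x y => some (q x, q y)
    | .eq _ _ => none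
  refine ⟨q, P.filterMap edge, fun G v => ⟨fun hv => ?_, ?_⟩⟩
  · have hr : r ≤ Setoid.ker v := Setoid.eqvGen_le fun x y hxy => hv _ hxy
    have hq : v ∘ q = v := funext fun n => hr (Quotient.mk_out n)
    refine ⟨v, fun e he => ?_, hq⟩
    obtain ⟨x | _, hP, hxy⟩ := List.mem_filterMap.1 he
    · obtain rfl := Option.some.inj hxy
      exact (congrArg₂ G.Adj (congrFun hq x) (congrFun hq _)).mpr (hv _ hP)
    · cases hxy
  · rintro ⟨w, hw, rfl⟩ (⟨x, y⟩ | ⟨x, y⟩) hP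
    · exact hw (q x, q y) (List.mem_filterMap.2 ⟨_, hP, rfl⟩)
    · exact congrArg (fun a => w a.out) (Quotient.sound (Relation.EqvGen.rel _ _ hP))

theorem exists_hornClause_satisfies_iff (Γ : UHSentence) : ∃ E x y head,
    ∀ G : DirGraph.{u}, G.Satisfies (hornClause E x y head) ↔ G.Satisfies Γ := by
  cases Γ with
  | horn P Φ =>
    obtain ⟨q, E, h⟩ := exists_edgesHold_comp_iff.{u} P
    have hP (G : DirGraph.{u}) : G.Satisfies (.horn P Φ) ↔
        ∀ w : ℕ → G.V, EdgesHold G w E → Φ.Realize (w ∘ q) := by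
      simp only [DirGraph.Satisfies, h, forall_exists_index, and_imp, forall_apply_eq_imp_iff₂]
    cases Φ with
    | adj x y => exact ⟨E, q x, q y, .adj, fun G => satisfies_hornClause_iff.trans (hP G).symm⟩
    | eq x y => exact ⟨E, q x, q y, .eq, fun G => satisfies_hornClause_iff.trans (hP G).symm⟩
  | neg Φ P =>
    obtain ⟨q, E, h⟩ := exists_edgesHold_comp_iff.{u} (Φ :: P)
    refine ⟨E, 0, 0, .falsum, fun G => ?_⟩
    simp only [satisfies_hornClause_iff, satisfies_neg_iff, h, not_exists, not_and,
      HornHead.Holds]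
    exact ⟨fun H _ w hw _ => H w hw, fun H w hw => H _ w hw rfl⟩

/-! ## Identities as universal Horn sentences -/

section

variable {G : DirGraph.{u}}

/-- The relation between terms that an identity splits into two of: whenever the value of `s` in
`A(G)` is nonzero, it is also the value of `t`. -/
def EvalLE (G : DirGraph.{u}) (s t : USTerm) : Prop :=
  ∀ (v : ℕ → AdjElem G.V) (x y : G.V), adjEval G v s = .pair x y → adjEval G v t = .pair x y

theorem satisfiesIdentity_iff_evalLE {s t : USTerm} :
    (adjacencySemigroup G).SatisfiesIdentity (s, t) ↔ EvalLE G s t ∧ EvalLE G t s :=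
  ⟨fun h => ⟨fun v _ _ hs => (h v).symm.trans hs, fun v _ _ ht => (h v).trans ht⟩,
    fun h v => AdjElem.ext_pair fun x y => ⟨h.1 v x y, h.2 v x y⟩⟩

theorem evalLE_iff_of_vars_subset {s t : USTerm} (hst : t.vars ⊆ s.vars) :
    EvalLE G s t ↔ ∀ g : ℕ → G.V, EdgesHold G g s.edges →
      EdgesHold G g t.edges ∧ g t.ends.1 = g s.ends.1 ∧ g t.ends.2 = g s.ends.2 := by
  constructor
  · intro h g hs
    exact adjEval_pairValuation_eq_pair_iff.1
      (h _ _ _ (adjEval_pairValuation_eq_pair_iff.2 ⟨hs, rfl, rfl⟩))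
  · intro h v x y hs
    obtain ⟨g, hg⟩ := exists_pairValuation_of_adjEval_eq_pair hs
    obtain ⟨hE, rfl, rfl⟩ :=
      adjEval_pairValuation_eq_pair_iff.1 ((USTerm.eval_congr hg).symm.trans hs)
    exact (USTerm.eval_congr fun n hn => hg n (hst hn)).trans
      (adjEval_pairValuation_eq_pair_iff.2 (h g hE))

theorem EvalLE.adjEval_ne_pair {s t : USTerm} (h : EvalLE G s t) {n : ℕ}
    (ht : n ∈ t.vars) (hs : n ∉ s.vars) (v : ℕ → AdjElem G.V) (x y : G.V) :
    adjEval G v s ≠ .pair x y := by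
  intro hv
  have hcongr : adjEval G (Function.update v n .zero) s = adjEval G v s :=
    USTerm.eval_congr fun m hm => Function.update_of_ne (ne_of_mem_of_not_mem hm hs) _ _
  obtain ⟨a, b, hab⟩ := exists_eq_pair_of_adjEval_eq_pair (h _ x y (hcongr.trans hv)) ht
  rw [Function.update_self] at hab
  cases hab

theorem evalLE_iff_of_not_vars_subset {s t : USTerm} (hst : ¬ t.vars ⊆ s.vars) :
    EvalLE G s t ↔ ∀ g : ℕ → G.V, ¬ EdgesHold G g s.edges := by
  obtain ⟨n, ht, hs⟩ := Finset.not_subset.1 hst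
  constructor
  · exact fun h g hg => h.adjEval_ne_pair ht hs _ _ _
      (adjEval_pairValuation_eq_pair_iff.2 ⟨hg, rfl, rfl⟩)
  · intro h v x y hv
    obtain ⟨g, hg, -⟩ := exists_adjEval_eq_pair_iff.1 ⟨v, hv⟩
    exact absurd hg (h g)

theorem exists_finite_satisfies_iff_evalLE (s t : USTerm) : ∃ B : Set UHSentence, B.Finite ∧
    ∀ G : DirGraph.{u}, (∀ Γ ∈ B, G.Satisfies Γ) ↔ EvalLE G s t := by
  by_cases hst : t.vars ⊆ s.vars
  · refine ⟨{hornClause s.edges t.ends.1 s.ends.1 .eq, hornClause s.edges t.ends.2 s.ends.2 .eq} ∪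
      (fun e => hornClause s.edges e.1 e.2 .adj) '' {e | e ∈ t.edges},
      (Set.toFinite _).union (t.edges.finite_toSet.image _), fun G => ?_⟩
    simp only [Set.mem_union, or_imp, forall_and, Set.forall_mem_insert, Set.forall_mem_image,
      Set.mem_singleton_iff, forall_eq, Set.mem_ofPred_eq, satisfies_hornClause_iff,
      evalLE_iff_of_vars_subset hst, HornHead.Holds]
    exact ⟨fun h => ⟨fun g hg e he => h.2 he g hg, h.1⟩,
      fun h => ⟨h.2, fun e he g hg => h.1 g hg e he⟩⟩
  · refine ⟨{hornClause s.edges 0 0 .falsum}, Set.finite_singleton _, fun G => ?_⟩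
    rw [evalLE_iff_of_not_vars_subset hst]
    simp only [Set.mem_singleton_iff, forall_eq]
    exact satisfies_hornClause_iff

theorem exists_finite_satisfies_iff_satisfiesIdentity (p : USTerm × USTerm) :
    ∃ B : Set UHSentence, B.Finite ∧ ∀ G : DirGraph.{u},
      (∀ Γ ∈ B, G.Satisfies Γ) ↔ (adjacencySemigroup G).SatisfiesIdentity p := by
  obtain ⟨B, hB, hBG⟩ := exists_finite_satisfies_iff_evalLE.{u} p.1 p.2
  obtain ⟨C, hC, hCG⟩ := exists_finite_satisfies_iff_evalLE.{u} p.2 p.1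
  refine ⟨B ∪ C, hB.union hC, fun G => ?_⟩
  simp only [Set.mem_union, or_imp, forall_and, hBG, hCG, ← satisfiesIdentity_iff_evalLE]

end

/-! ## Universal Horn sentences as identities -/

section

variable {G : DirGraph.{u}}

theorem satisfiesIdentity_rev_mul_self_iff {t : USTerm} :
    (adjacencySemigroup G).SatisfiesIdentity (.rev t, .mul (.rev t) (.rev t)) ↔
      ∀ v x y, adjEval G v t = .pair x y → G.Adj x y := by
  simp only [satisfiesIdentity_iff_evalLE, EvalLE, adjEval_mul, adjEval_rev,
    AdjElem.rev_eq_pair_iff, AdjElem.mul_eq_pair_iff]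
  constructor
  · rintro ⟨h, -⟩ v x y hv
    obtain ⟨_, _, hx, hy, hadj⟩ := h v y x hv
    rw [hv] at hx hy
    cases hx
    cases hy
    exact hadj
  · intro h
    refine ⟨fun v x y hv => ⟨y, x, hv, hv, h v y x hv⟩, ?_⟩
    rintro v x y ⟨_, _, hx, hy, -⟩
    cases hx.symm.trans hy
    exact hx

theorem satisfiesIdentity_rev_iff {t : USTerm} :
    (adjacencySemigroup G).SatisfiesIdentity (t, .rev t) ↔
      ∀ v x y, adjEval G v t = .pair x y → x = y := by
  simp only [satisfiesIdentity_iff_evalLE, EvalLE, adjEval_rev, AdjElem.rev_eq_pair_iff]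
  constructor
  · rintro ⟨h, -⟩ v x y hv
    cases hv.symm.trans (h v x y hv)
    rfl
  · refine fun h => ⟨fun v x y hv => ?_, fun v x y hv => ?_⟩
    all_goals
      obtain rfl := h _ _ _ hv
      exact hv

theorem satisfiesIdentity_mul_var_iff {t : USTerm} {n : ℕ} (hn : n ∉ t.vars) :
    (adjacencySemigroup G).SatisfiesIdentity (t, .mul t (.var n)) ↔
      ∀ v x y, adjEval G v t ≠ .pair x y := by
  rw [satisfiesIdentity_iff_evalLE]
  constructor
  · rintro ⟨h, -⟩
    exact h.adjEval_ne_pair (Finset.mem_union_right _ (Finset.mem_singleton_self n)) hn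
  · refine fun h => ⟨fun v x y hv => absurd hv (h v x y), fun v x y hv => ?_⟩
    obtain ⟨_, _, ht, -⟩ := AdjElem.mul_eq_pair_iff.1 hv
    exact absurd ht (h _ _ _)

theorem exists_satisfiesIdentity_iff_holds (t : USTerm) (head : HornHead) :
    ∃ p : USTerm × USTerm, ∀ G : DirGraph.{u}, (adjacencySemigroup G).SatisfiesIdentity p ↔
      ∀ v x y, adjEval G v t = .pair x y → head.Holds G x y := by
  cases head with
  | adj => exact ⟨_, fun G => satisfiesIdentity_rev_mul_self_iff⟩
  | eq => exact ⟨_, fun G => satisfiesIdentity_rev_iff⟩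
  | falsum =>
    obtain ⟨n, hn⟩ := Infinite.exists_notMem_finset t.vars
    exact ⟨_, fun G => satisfiesIdentity_mul_var_iff hn⟩

theorem satisfiesIdentity_regular_iff :
    (adjacencySemigroup G).SatisfiesIdentity
        (.var 0, .mul (.mul (.var 0) (.rev (.var 0))) (.var 0)) ↔ ∀ x, G.Adj x x := by
  simp only [satisfiesIdentity_iff_evalLE, EvalLE, adjEval_mul, adjEval_rev, adjEval_var,
    AdjElem.rev_eq_pair_iff, AdjElem.mul_eq_pair_iff]
  constructor
  · rintro ⟨h, -⟩ x
    obtain ⟨_, _, ⟨_, _, hy, hz, hadj⟩, -⟩ := h (fun _ => .pair x x) x x rfl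
    cases hy
    cases hz
    exact hadj
  · refine fun h => ⟨fun v x y hv => ⟨x, x, ⟨y, y, hv, hv, h y⟩, hv, h x⟩, ?_⟩
    rintro v x y ⟨_, _, ⟨_, _, hx, -, -⟩, hy, -⟩
    cases hx.symm.trans hy
    exact hx

/-- The term `(z t')'` with `z` the variable `0`: its value arises from that of `t` by replacing the
right vertex with the left vertex of `z`, if the right vertex of `z` is joined to the replaced
one. -/
def redirect (t : USTerm) : USTerm :=
  .rev (.mul (.var 0) (.rev t))

/-- A term whose nonzero values record that the edges `E` are present between the left vertices of
the variables. Its left vertex is that of `x`. Variables are shifted by one, since `0` is reserved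
for `redirect`. -/
def edgesTerm (x : ℕ) : List (ℕ × ℕ) → USTerm
  | [] => redirect (.var (x + 1))
  | e :: E => redirect (.mul (edgesTerm x E) (.mul (.rev (.var (e.1 + 1))) (.var (e.2 + 1))))

theorem ends_edgesTerm (x : ℕ) (E : List (ℕ × ℕ)) :
    (edgesTerm x E).ends = (2 * (x + 1), 0) := by
  induction E with
  | nil => rfl
  | cons e E ih => simp [edgesTerm, redirect, USTerm.ends, ih]

theorem edgesHold_edges_edgesTerm_iff {g : ℕ → G.V} {x : ℕ}
    {E : List (ℕ × ℕ)} : EdgesHold G g (edgesTerm x E).edges ↔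
      G.Adj (g 1) (g (2 * (x + 1) + 1)) ∧
        ∀ e ∈ E, G.Adj (g (2 * (e.1 + 1))) (g (2 * (e.2 + 1))) ∧
          G.Adj (g 0) (g (2 * (e.1 + 1) + 1)) ∧ G.Adj (g 1) (g (2 * (e.2 + 1) + 1)) := by
  induction E with
  | nil => simp [edgesTerm, redirect, USTerm.edges, USTerm.ends, edgesHold_cons, edgesHold_nil]
  | cons e E ih =>
    simp only [edgesTerm, redirect, USTerm.edges, USTerm.ends, edgesHold_cons, edgesHold_append,
      edgesHold_nil, ih, ends_edgesTerm, List.forall_mem_cons, Prod.fst_swap, Prod.snd_swap]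
    tauto

/-- A term taking in `A(G)` as nonzero values the pairs of vertices that can be assigned to `x` and
`y` when the edges `E` are present. -/
def premiseTerm (E : List (ℕ × ℕ)) (x y : ℕ) : USTerm :=
  .mul (edgesTerm x E) (.rev (.var (y + 1)))

theorem ends_premiseTerm (E : List (ℕ × ℕ)) (x y : ℕ) :
    (premiseTerm E x y).ends = (2 * (x + 1), 2 * (y + 1)) := by
  simp [premiseTerm, USTerm.ends, ends_edgesTerm]

theorem edgesHold_edges_premiseTerm_iff {g : ℕ → G.V} {E : List (ℕ × ℕ)}
    {x y : ℕ} : EdgesHold G g (premiseTerm E x y).edges ↔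
      G.Adj (g 0) (g (2 * (y + 1) + 1)) ∧ EdgesHold G g (edgesTerm x E).edges := by
  simp [premiseTerm, USTerm.edges, USTerm.ends, ends_edgesTerm, edgesHold_cons]

theorem exists_adjEval_premiseTerm_iff {E : List (ℕ × ℕ)} (hE : E ≠ [])
    {x y : ℕ} {a b : G.V} : (∃ v, adjEval G v (premiseTerm E x y) = .pair a b) ↔
      ∃ w : ℕ → G.V, EdgesHold G w E ∧ w x = a ∧ w y = b := by
  simp only [exists_adjEval_eq_pair_iff, ends_premiseTerm, edgesHold_edges_premiseTerm_iff,
    edgesHold_edges_edgesTerm_iff]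
  constructor
  · rintro ⟨g, ⟨-, -, hg⟩, hx, hy⟩
    exact ⟨fun n => g (2 * (n + 1)), fun e he => (hg e he).1, hx, hy⟩
  · rintro ⟨w, hw, hx, hy⟩
    -- A single edge `c ∼ d` of `E` supplies all the auxiliary edges.
    obtain ⟨⟨c, d⟩, hcd⟩ := List.exists_mem_of_ne_nil E hE
    obtain ⟨g, hl, hr⟩ := exists_interleave (fun | 0 => w c | n + 1 => w n)
      (fun | 0 => w c | _ + 1 => w d)
    have h : G.Adj (w c) (w d) := hw _ hcd
    have h0 : g 0 = w c := hl 0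
    have h1 : g 1 = w c := hr 0
    refine ⟨g, ?_⟩
    simp only [hl, hr, h0, h1]
    exact ⟨⟨h, h, fun e he => ⟨hw e he, h, h⟩⟩, hx, hy⟩

theorem exists_adjEval_var_zero_iff {x y : ℕ} (hxy : x ≠ y) {a b : G.V} :
    (∃ v, adjEval G v (.var 0) = .pair a b) ↔
      ∃ w : ℕ → G.V, EdgesHold G w [] ∧ w x = a ∧ w y = b :=
  iff_of_true ⟨fun _ => .pair a b, rfl⟩
    ⟨fun n => if n = x then a else b, edgesHold_nil, if_pos rfl, if_neg hxy.symm⟩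

theorem exists_term_adjEval_eq_pair_iff {E : List (ℕ × ℕ)} {x y : ℕ} (h : E = [] → x ≠ y) :
    ∃ t : USTerm, ∀ (G : DirGraph.{u}) (a b : G.V), (∃ v, adjEval G v t = .pair a b) ↔
      ∃ w : ℕ → G.V, EdgesHold G w E ∧ w x = a ∧ w y = b := by
  by_cases hE : E = []
  · subst hE
    exact ⟨.var 0, fun G a b => exists_adjEval_var_zero_iff (h rfl)⟩
  · exact ⟨premiseTerm E x y, fun G a b => exists_adjEval_premiseTerm_iff hE⟩

theorem exists_satisfiesIdentity_iff_hornClause_of_ne {E : List (ℕ × ℕ)} {x y : ℕ}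
    (h : E = [] → x ≠ y) (head : HornHead) : ∃ p : USTerm × USTerm, ∀ G : DirGraph.{u},
      (adjacencySemigroup G).SatisfiesIdentity p ↔ G.Satisfies (hornClause E x y head) := by
  obtain ⟨t, ht⟩ := exists_term_adjEval_eq_pair_iff.{u} h
  obtain ⟨p, hp⟩ := exists_satisfiesIdentity_iff_holds.{u} t head
  refine ⟨p, fun G => ?_⟩
  rw [hp, satisfies_hornClause_iff]
  constructor
  · intro H w hw
    obtain ⟨v, hv⟩ := (ht G _ _).2 ⟨w, hw, rfl, rfl⟩
    exact H v _ _ hv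
  · intro H v a b hv
    obtain ⟨w, hw, rfl, rfl⟩ := (ht G a b).1 ⟨v, hv⟩
    exact H w hw

theorem exists_satisfiesIdentity_iff_hornClause (E : List (ℕ × ℕ)) (x y : ℕ) (head : HornHead) :
    ∃ p : USTerm × USTerm, ∀ G : DirGraph.{u},
      (adjacencySemigroup G).SatisfiesIdentity p ↔ G.Satisfies (hornClause E x y head) := by
  by_cases h : E = [] → x ≠ y
  · exact exists_satisfiesIdentity_iff_hornClause_of_ne h head
  obtain ⟨rfl, rfl⟩ : E = [] ∧ x = y := by simpa using h
  cases head with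
  | adj =>
    refine ⟨_, fun G => satisfiesIdentity_regular_iff.trans ?_⟩
    rw [satisfies_hornClause_iff]
    exact ⟨fun H v _ => H (v x), fun H a => H (fun _ => a) edgesHold_nil⟩
  | eq =>
    exact ⟨(.var 0, .var 0), fun G => iff_of_true (fun _ => rfl)
      (satisfies_hornClause_iff.2 fun _ _ => rfl)⟩
  | falsum =>
    exact exists_satisfiesIdentity_iff_hornClause_of_ne (y := x + 1) (fun _ => x.lt_succ_self.ne)
      .falsum

theorem exists_satisfiesIdentity_iff_satisfies (Γ : UHSentence) :
    ∃ p : USTerm × USTerm, ∀ G : DirGraph.{u},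
      (adjacencySemigroup G).SatisfiesIdentity p ↔ G.Satisfies Γ := by
  obtain ⟨E, x, y, head, hΓ⟩ := exists_hornClause_satisfies_iff.{u} Γ
  obtain ⟨p, hp⟩ := exists_satisfiesIdentity_iff_hornClause.{u} E x y head
  exact ⟨p, fun G => (hp G).trans (hΓ G)⟩

end

theorem forall_satisfiesIdentity_iff_forall_satisfies {K : Set DirGraph.{u}} {G : DirGraph.{u}} :
    (∀ p, (∀ S ∈ adjacencyClass K, S.SatisfiesIdentity p) →
        (adjacencySemigroup G).SatisfiesIdentity p) ↔
      ∀ Γ, (∀ H ∈ K, H.Satisfies Γ) → G.Satisfies Γ := by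
  simp only [adjacencyClass, Set.forall_mem_image]
  constructor
  · intro h Γ hΓ
    obtain ⟨p, hp⟩ := exists_satisfiesIdentity_iff_satisfies.{u} Γ
    exact (hp G).1 (h p fun H hH => (hp H).2 (hΓ H hH))
  · intro h p hp
    obtain ⟨B, -, hB⟩ := exists_finite_satisfies_iff_satisfiesIdentity.{u} p
    exact (hB G).1 fun Γ hΓ => h Γ fun H hH => (hB H).2 (hp hH) Γ hΓ

theorem hasFiniteUHBasis_of_hasFiniteIdentityBasis {K : Set DirGraph.{u}}
    (h : HasFiniteIdentityBasis (adjacencyClass K)) : HasFiniteUHBasis K := by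
  obtain ⟨B, hfin, hB⟩ := h
  choose σ hσ hσG using exists_finite_satisfies_iff_satisfiesIdentity.{u}
  refine ⟨⋃ p ∈ B, σ p, hfin.biUnion fun p _ => hσ p, fun G => ?_⟩
  have hG : (∀ Γ ∈ ⋃ p ∈ B, σ p, G.Satisfies Γ) ↔
      ∀ p ∈ B, (adjacencySemigroup G).SatisfiesIdentity p := by
    simp only [← hσG, Set.mem_iUnion₂, forall_exists_index]
    exact ⟨fun H p hp Γ hΓ => H Γ p hp hΓ, fun H Γ p hp hΓ => H p hp Γ hΓ⟩
  rw [hG, hB, forall_satisfiesIdentity_iff_forall_satisfies]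

/-! ## Varieties -/

theorem UnarySemigroup.IsHom.map_eval {S T : UnarySemigroup.{u}} {f : S.carrier → T.carrier}
    (hf : S.IsHom T f) (v : ℕ → S.carrier) (t : USTerm) : f (t.eval S v) = t.eval T (f ∘ v) := by
  induction t with
  | var x => rfl
  | mul s t ihs iht => exact (hf.map_mul _ _).trans (congrArg₂ (· * ·) ihs iht)
  | rev s ih => exact (hf.map_rev _).trans (congrArg T.rev ih)

theorem isUSVariety_setOf_satisfiesIdentity (p : USTerm × USTerm) :
    IsUSVariety {S : UnarySemigroup.{u} | S.SatisfiesIdentity p} where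
  image S T hS f hf hsurj v := by
    obtain ⟨w, rfl⟩ := hsurj.comp_left v
    exact (hf.map_eval w p.1).symm.trans ((congrArg f (hS w)).trans (hf.map_eval w p.2))
  sub S T hT f hf hinj v :=
    hinj ((hf.map_eval v p.1).trans ((hT (f ∘ v)).trans (hf.map_eval v p.2).symm))
  prod I S hS v := by
    funext i
    have hproj : (UnarySemigroup.prod S).IsHom (S i) (fun a => a i) :=
      ⟨fun _ _ => rfl, fun _ => rfl⟩
    exact (hproj.map_eval v p.1).trans ((hS i _).trans (hproj.map_eval v p.2).symm)

theorem isUSVariety_varietyGenerated (C : Set UnarySemigroup.{u}) :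
    IsUSVariety (varietyGenerated C) where
  image S T hS f hf hs W hW := hW.1.image S T (hS W hW) f hf hs
  sub S T hT f hf hs W hW := hW.1.sub S T (hT W hW) f hf hs
  prod I S hS W hW := hW.1.prod I S fun i => hS i W hW

theorem subset_varietyGenerated (C : Set UnarySemigroup.{u}) : C ⊆ varietyGenerated C :=
  fun _ hS _ hW => hW.2 hS

theorem varietyGenerated_subset {C W : Set UnarySemigroup.{u}} (hW : IsUSVariety W)
    (h : C ⊆ W) : varietyGenerated C ⊆ W :=
  fun _ hS => hS W ⟨hW, h⟩

theorem satisfiesIdentity_of_mem_varietyGenerated {C : Set UnarySemigroup.{u}}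
    {S : UnarySemigroup.{u}} (hS : S ∈ varietyGenerated C) {p : USTerm × USTerm}
    (hp : ∀ T ∈ C, T.SatisfiesIdentity p) : S.SatisfiesIdentity p :=
  varietyGenerated_subset (isUSVariety_setOf_satisfiesIdentity p) hp hS

/-! ## Reduced products -/

/-- `π` exhibits `P` as the reduced product of the graphs `H i` over the filter `F`: the direct
product for `F = ⊤`, an ultraproduct when `F` is an ultrafilter. -/
structure IsReducedProduct {I : Type u} (F : Filter I) (H : I → DirGraph.{u}) (P : DirGraph.{u})
    (π : (∀ i, (H i).V) → P.V) : Prop where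
  surjective : Function.Surjective π
  eq_iff : ∀ f g, π f = π g ↔ ∀ᶠ i in F, f i = g i
  adj_iff : ∀ f g, P.Adj (π f) (π g) ↔ ∀ᶠ i in F, (H i).Adj (f i) (g i)

theorem isReducedProduct_prod {I : Type u} (H : I → DirGraph.{u}) :
    IsReducedProduct ⊤ H (DirGraph.prod H) id where
  surjective := Function.surjective_id
  eq_iff f g := by rw [Filter.eventually_top]; exact funext_iff
  adj_iff f g := by rw [Filter.eventually_top]; rfl

theorem isReducedProduct_ultraproduct {I : Type u} (U : Ultrafilter I) (H : I → DirGraph.{u}) :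
    IsReducedProduct U H (DirGraph.ultraproduct U H) (Quotient.mk _) where
  surjective := Quotient.mk_surjective
  eq_iff f g := Quotient.eq
  adj_iff f g := by
    refine ⟨?_, fun h => ⟨f, g, rfl, rfl, h⟩⟩
    rintro ⟨f', g', hf, hg, h⟩
    have hf' : ∀ᶠ i in (U : Filter I), f i = f' i := Quotient.exact hf
    have hg' : ∀ᶠ i in (U : Filter I), g i = g' i := Quotient.exact hg
    filter_upwards [hf', hg', h] with i hfi hgi hi
    rwa [hfi, hgi]

namespace IsReducedProduct

variable {I : Type u} {F : Filter I} {H : I → DirGraph.{u}} {P : DirGraph.{u}}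
  {π : (∀ i, (H i).V) → P.V}

theorem holds_iff [F.NeBot] (hπ : IsReducedProduct F H P π) (head : HornHead)
    (f g : ∀ i, (H i).V) :
    head.Holds P (π f) (π g) ↔ ∀ᶠ i in F, head.Holds (H i) (f i) (g i) := by
  cases head with
  | adj => exact hπ.adj_iff f g
  | eq => exact hπ.eq_iff f g
  | falsum => exact Filter.eventually_const.symm

theorem exists_eq_pair_iff (hπ : IsReducedProduct F H P π)
    (a : ∀ i, AdjElem (H i).V) : ∃ b : AdjElem P.V, ∀ x y, b = .pair x y ↔
      ∃ f g, (∀ᶠ i in F, a i = .pair (f i) (g i)) ∧ π f = x ∧ π g = y := by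
  by_cases h : ∃ f g : ∀ i, (H i).V, ∀ᶠ i in F, a i = .pair (f i) (g i)
  · obtain ⟨f, g, hfg⟩ := h
    refine ⟨.pair (π f) (π g), fun x y => ⟨fun hxy => ?_, ?_⟩⟩
    · cases hxy
      exact ⟨f, g, hfg, rfl, rfl⟩
    · rintro ⟨f', g', hfg', rfl, rfl⟩
      have heq : ∀ᶠ i in F, f i = f' i ∧ g i = g' i := by
        filter_upwards [hfg, hfg'] with i hi hi'
        exact AdjElem.pair.inj (hi.symm.trans hi')
      rw [(hπ.eq_iff f f').2 (heq.mono fun _ hi => hi.1),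
        (hπ.eq_iff g g').2 (heq.mono fun _ hi => hi.2)]
  · refine ⟨.zero, fun x y => iff_of_false nofun ?_⟩
    rintro ⟨f, g, hfg, -⟩
    exact h ⟨f, g, hfg⟩

theorem isHom_of_eq_pair_iff (hπ : IsReducedProduct F H P π)
    {φ : (∀ i, AdjElem (H i).V) → AdjElem P.V} (hφ : ∀ a x y, φ a = .pair x y ↔
      ∃ f g, (∀ᶠ i in F, a i = .pair (f i) (g i)) ∧ π f = x ∧ π g = y) :
    (UnarySemigroup.prod fun i => adjacencySemigroup (H i)).IsHom (adjacencySemigroup P) φ where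
  map_mul a b := AdjElem.ext_pair fun x t => by
    refine (hφ _ x t).trans (Iff.trans ?_ AdjElem.mul_eq_pair_iff.symm)
    constructor
    · rintro ⟨f, k, h, rfl, rfl⟩
      have : ∀ i, Nonempty ((H i).V × (H i).V) := fun i => ⟨f i, f i⟩
      have h' : ∀ᶠ i in F, ∃ q : (H i).V × (H i).V,
          a i = .pair (f i) q.1 ∧ b i = .pair q.2 (k i) ∧ (H i).Adj q.1 q.2 :=
        h.mono fun i hi => Prod.exists.2 (AdjElem.mul_eq_pair_iff.1 hi)
      obtain ⟨q, hq⟩ := Filter.skolem.1 h'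
      exact ⟨π fun i => (q i).1, π fun i => (q i).2,
        (hφ _ _ _).2 ⟨_, _, hq.mono fun i hi => hi.1, rfl, rfl⟩,
        (hφ _ _ _).2 ⟨_, _, hq.mono fun i hi => hi.2.1, rfl, rfl⟩,
        (hπ.adj_iff _ _).2 (hq.mono fun i hi => hi.2.2)⟩
    · rintro ⟨y, z, hφa, hφb, hadj⟩
      obtain ⟨f, g, ha, rfl, rfl⟩ := (hφ a _ _).1 hφa
      obtain ⟨h, k, hb, rfl, rfl⟩ := (hφ b _ _).1 hφb
      refine ⟨f, k, ?_, rfl, rfl⟩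
      filter_upwards [ha, hb, (hπ.adj_iff g h).1 hadj] with i hai hbi hi
      exact AdjElem.mul_eq_pair_iff.2 ⟨_, _, hai, hbi, hi⟩
  map_rev a := AdjElem.ext_pair fun x y => by
    refine (hφ _ x y).trans (Iff.trans ?_ (AdjElem.rev_eq_pair_iff.trans (hφ a y x)).symm)
    refine exists_comm.trans (exists₂_congr fun f g => and_congr ?_ and_comm)
    exact Filter.eventually_congr (.of_forall fun i => AdjElem.rev_eq_pair_iff)

theorem adjacencySemigroup_mem [F.NeBot] (hπ : IsReducedProduct F H P π)
    {W : Set UnarySemigroup.{u}} (hW : IsUSVariety W) (hH : ∀ i, adjacencySemigroup (H i) ∈ W) :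
    adjacencySemigroup P ∈ W := by
  choose φ hφ using hπ.exists_eq_pair_iff
  refine hW.image _ _ (hW.prod I _ hH) φ (hπ.isHom_of_eq_pair_iff hφ) ?_
  rintro (_ | ⟨x, y⟩)
  · refine ⟨fun _ => AdjElem.zero, AdjElem.ext_pair fun x y =>
      (hφ _ x y).trans (iff_of_false ?_ nofun)⟩
    rintro ⟨f, g, h, -⟩
    obtain ⟨i, hi⟩ := h.exists
    cases hi
  · obtain ⟨f, rfl⟩ := hπ.surjective x
    obtain ⟨g, rfl⟩ := hπ.surjective y
    exact ⟨fun i => .pair (f i) (g i), (hφ _ _ _).2 ⟨f, g, .of_forall fun _ => rfl, rfl, rfl⟩⟩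

end IsReducedProduct

theorem IsUSVariety.mem_of_subsingleton {W : Set UnarySemigroup.{u}} (hW : IsUSVariety W)
    (S : UnarySemigroup.{u}) [Subsingleton S.carrier] : S ∈ W :=
  hW.sub S _ (hW.prod PEmpty PEmpty.elim PEmpty.rec) (fun _ => PEmpty.rec)
    ⟨fun _ _ => funext PEmpty.rec, fun _ => funext PEmpty.rec⟩
    (Function.injective_of_subsingleton _)

theorem IsUSVariety.adjacencySemigroup_mem_of_embedding {W : Set UnarySemigroup.{u}}
    (hW : IsUSVariety W) {G H : DirGraph.{u}} (e : G.Adj ↪r H.Adj)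
    (hH : adjacencySemigroup H ∈ W) : adjacencySemigroup G ∈ W := by
  let f : AdjElem G.V → AdjElem H.V
    | .zero => .zero
    | .pair x y => .pair (e x) (e y)
  refine hW.sub _ _ hH f ⟨?_, ?_⟩ ?_
  · rintro (_ | ⟨x, y⟩) (_ | ⟨z, t⟩) <;> try rfl
    change f (AdjElem.mul G _ _) = AdjElem.mul H _ _
    have hadj : H.Adj (e y) (e z) ↔ G.Adj y z := e.map_rel_iff
    by_cases h : G.Adj y z <;> simp [AdjElem.mul, f, hadj, h]
  · rintro (_ | ⟨x, y⟩) <;> rfl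
  · rintro (_ | ⟨x, y⟩) (_ | ⟨z, t⟩) h
    · rfl
    · cases h
    · cases h
    · obtain ⟨hx, hy⟩ := AdjElem.pair.inj h
      rw [e.injective hx, e.injective hy]

theorem IsUSVariety.isUHClass_preimage {W : Set UnarySemigroup.{u}} (hW : IsUSVariety W) :
    IsUHClass (adjacencySemigroup ⁻¹' W) where
  nonempty := by
    have : Subsingleton (AdjElem PEmpty.{u + 1}) :=
      ⟨by rintro (_ | ⟨⟨⟩, _⟩) (_ | ⟨⟨⟩, _⟩); rfl⟩
    exact ⟨⟨PEmpty, ⊥⟩, @IsUSVariety.mem_of_subsingleton _ hW _ this⟩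
  induced _ _ hH := fun ⟨e⟩ => hW.adjacencySemigroup_mem_of_embedding e hH
  prod _ _ H hH := (isReducedProduct_prod H).adjacencySemigroup_mem hW hH
  ultraproduct _ U H hH := (isReducedProduct_ultraproduct U H).adjacencySemigroup_mem hW hH

/-! ## Axiomatizability of universal Horn classes -/

theorem IsUHClass.mem_of_isEmpty {M : Set DirGraph.{u}} (hM : IsUHClass M) (G : DirGraph.{u})
    [IsEmpty G.V] : G ∈ M := by
  obtain ⟨H, hH⟩ := hM.nonempty
  exact hM.induced G H hH ⟨⟨⟨isEmptyElim, isEmptyElim⟩, fun {a} => isEmptyElim a⟩⟩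

section

variable {M : Set DirGraph.{u}} {G : DirGraph.{u}}

theorem exists_mem_not_holds_of_edgesHold
    (hG : ∀ Γ : UHSentence, (∀ H ∈ M, H.Satisfies Γ) → G.Satisfies Γ) {e : ℕ → G.V}
    {E : List (ℕ × ℕ)} (hE : EdgesHold G e E) {x y : ℕ} {head : HornHead}
    (hxy : ¬ head.Holds G (e x) (e y)) :
    ∃ H ∈ M, ∃ v : ℕ → H.V, EdgesHold H v E ∧ ¬ head.Holds H (v x) (v y) := by
  by_contra! hM
  refine hxy (satisfies_hornClause_iff.1 (hG _ fun H hH => ?_) e hE)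
  exact satisfies_hornClause_iff.2 (hM H hH)

theorem exists_mem_not_holds_of_finite
    (hG : ∀ Γ : UHSentence, (∀ H ∈ M, H.Satisfies Γ) → G.Satisfies Γ) {F : Set (G.V × G.V)}
    (hF : F.Finite) (hFG : ∀ p ∈ F, G.Adj p.1 p.2) {x y : G.V} {head : HornHead}
    (hxy : ¬ head.Holds G x y) :
    ∃ H ∈ M, ∃ h : G.V → H.V, (∀ p ∈ F, H.Adj (h p.1) (h p.2)) ∧ ¬ head.Holds H (h x) (h y) := by
  let S := {x, y} ∪ (Prod.fst '' F ∪ Prod.snd '' F)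
  have hS : S.Finite := (Set.toFinite _).union ((hF.image _).union (hF.image _))
  obtain ⟨c, hc⟩ := Set.countable_iff_exists_injOn.1 hS.countable
  have : Nonempty G.V := ⟨x⟩
  obtain ⟨e, he⟩ : ∃ e, Set.LeftInvOn e c S := ⟨_, hc.leftInvOn_invFunOn⟩
  let E := hF.toFinset.toList.map (Prod.map c c)
  have hE (H : DirGraph.{u}) (v : ℕ → H.V) :
      EdgesHold H v E ↔ ∀ p ∈ F, H.Adj (v (c p.1)) (v (c p.2)) := by
    simp only [EdgesHold, E, List.forall_mem_map, Finset.mem_toList, Set.Finite.mem_toFinset,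
      Prod.map_fst, Prod.map_snd]
  have hEG : EdgesHold G e E := by
    refine (hE G _).2 fun p hp => ?_
    rw [he (.inr (.inl ⟨p, hp, rfl⟩)), he (.inr (.inr ⟨p, hp, rfl⟩))]
    exact hFG p hp
  have hxy' : ¬ head.Holds G (e (c x)) (e (c y)) := by
    rwa [he (.inl (.inl rfl)), he (.inl (.inr rfl))]
  obtain ⟨H, hH, v, hv, hnot⟩ := exists_mem_not_holds_of_edgesHold hG hEG hxy'
  exact ⟨H, hH, v ∘ c, (hE H v).1 hv, hnot⟩

theorem IsUHClass.exists_hom_not_holds (hM : IsUHClass M)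
    (hG : ∀ Γ : UHSentence, (∀ H ∈ M, H.Satisfies Γ) → G.Satisfies Γ) {x y : G.V}
    {head : HornHead} (hxy : ¬ head.Holds G x y) :
    ∃ H ∈ M, ∃ h : G.Adj →r H.Adj, ¬ head.Holds H (h x) (h y) := by
  let D := {p : G.V × G.V // G.Adj p.1 p.2}
  choose H hH h hadj hnot using fun F : Finset D =>
    exists_mem_not_holds_of_finite hG (F.finite_toSet.image Subtype.val)
      (Set.forall_mem_image.2 fun p _ => p.2) hxy
  let U : Ultrafilter (Finset D) := Ultrafilter.of Filter.atTop
  have hU := isReducedProduct_ultraproduct U H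
  refine ⟨DirGraph.ultraproduct U H, hM.ultraproduct _ U H hH,
    ⟨fun a => Quotient.mk _ fun F => h F a, fun {a b} hab => ?_⟩, fun hxy' => ?_⟩
  · have hmem : ∀ᶠ F in (U : Filter (Finset D)), {⟨(a, b), hab⟩} ≤ F :=
      Ultrafilter.of_le _ (Filter.eventually_ge_atTop _)
    exact (hU.adj_iff _ _).2 (hmem.mono fun F hF =>
      hadj F (a, b) ⟨_, hF (Finset.mem_singleton_self _), rfl⟩)
  · obtain ⟨F, hF⟩ := ((hU.holds_iff head _ _).1 hxy').exists
    exact hnot F hF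

theorem IsUHClass.mem_of_satisfies (hM : IsUHClass M)
    (hG : ∀ Γ : UHSentence, (∀ H ∈ M, H.Satisfies Γ) → G.Satisfies Γ) : G ∈ M := by
  rcases isEmpty_or_nonempty G.V with hV | ⟨⟨a⟩⟩
  · exact hM.mem_of_isEmpty G
  let J := {j : HornHead × G.V × G.V // ¬ j.1.Holds G j.2.1 j.2.2}
  have : Nonempty J := ⟨⟨(.falsum, a, a), not_false⟩⟩
  choose H hH h hnot using fun j : J => hM.exists_hom_not_holds hG j.2
  have hreflect {head : HornHead} {x y : G.V} (hxy : ∀ j, head.Holds (H j) (h j x) (h j y)) :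
      head.Holds G x y := by
    by_contra hG
    exact hnot ⟨(head, x, y), hG⟩ (hxy _)
  refine hM.induced G (DirGraph.prod H) (hM.prod _ H hH) ⟨⟨⟨fun x j => h j x, ?_⟩, ?_⟩⟩
  · exact fun x y hxy => hreflect (head := .eq) (congrFun hxy)
  · exact fun {x y} => ⟨hreflect (head := .adj), fun hxy j => (h j).map_rel hxy⟩

end

/-! ## The correspondence between universal Horn classes and varieties -/

theorem isUHClass_uhClassGenerated (K : Set DirGraph.{u}) : IsUHClass (uhClassGenerated K) where
  nonempty := ⟨⟨PEmpty, ⊥⟩, fun _ hL =>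
    @IsUHClass.mem_of_isEmpty _ hL.1 _ (inferInstanceAs (IsEmpty PEmpty))⟩
  induced G H hH e L hL := hL.1.induced G H (hH L hL) e
  prod I _ H hH L hL := hL.1.prod I H fun i => hH i L hL
  ultraproduct I U H hH L hL := hL.1.ultraproduct I U H fun i => hH i L hL

theorem subset_uhClassGenerated (K : Set DirGraph.{u}) : K ⊆ uhClassGenerated K :=
  fun _ hG _ hL => hL.2 hG

theorem IsUHClass.uhClassGenerated_subset {K M : Set DirGraph.{u}} (hM : IsUHClass M)
    (h : K ⊆ M) : uhClassGenerated K ⊆ M :=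
  fun _ hG => hG M ⟨hM, h⟩

theorem IsUHClass.uhClassGenerated_eq {M : Set DirGraph.{u}} (hM : IsUHClass M) :
    uhClassGenerated M = M :=
  (hM.uhClassGenerated_subset subset_rfl).antisymm (subset_uhClassGenerated M)

theorem preimage_varietyGenerated_adjacencyClass (K : Set DirGraph.{u}) :
    adjacencySemigroup ⁻¹' varietyGenerated (adjacencyClass K) = uhClassGenerated K := by
  apply Set.Subset.antisymm
  · intro G hG
    refine (isUHClass_uhClassGenerated K).mem_of_satisfies fun Γ hΓ => ?_
    exact forall_satisfiesIdentity_iff_forall_satisfies.1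
      (fun p hp => satisfiesIdentity_of_mem_varietyGenerated hG hp) Γ
      fun H hH => hΓ H (subset_uhClassGenerated K hH)
  · exact (isUSVariety_varietyGenerated _).isUHClass_preimage.uhClassGenerated_subset
      fun G hG => subset_varietyGenerated _ ⟨G, hG, rfl⟩

theorem injOn_varietyGenerated_adjacencyClass (L : Set DirGraph.{u}) :
    Set.InjOn (fun M => varietyGenerated (adjacencyClass M)) (subUHClasses L) :=
  Set.LeftInvOn.injOn (f₁' := fun W => adjacencySemigroup ⁻¹' W) fun M hM =>
    (preimage_varietyGenerated_adjacencyClass M).trans hM.1.uhClassGenerated_eq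

theorem mapsTo_varietyGenerated_adjacencyClass (K : Set DirGraph.{u}) :
    Set.MapsTo (fun M => varietyGenerated (adjacencyClass M)) (subUHClasses (uhClassGenerated K))
      (subvarieties (varietyGenerated (adjacencyClass K))) := by
  intro M hM
  refine ⟨isUSVariety_varietyGenerated _,
    varietyGenerated_subset (isUSVariety_varietyGenerated _) (Set.image_subset_iff.2 ?_)⟩
  exact hM.2.trans (preimage_varietyGenerated_adjacencyClass K).ge

theorem proposition5 (K : Set DirGraph.{u}) :
    (¬ HasFiniteUHBasis K → ¬ HasFiniteIdentityBasis (adjacencyClass K)) ∧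
    ((subUHClasses (uhClassGenerated K)).Infinite →
      (subvarieties (varietyGenerated (adjacencyClass K))).Infinite) ∧
    (¬ (subUHClasses (uhClassGenerated K)).Countable →
      ¬ (subvarieties (varietyGenerated (adjacencyClass K))).Countable) := by
  have hinj := injOn_varietyGenerated_adjacencyClass (uhClassGenerated K)
  have hmaps := mapsTo_varietyGenerated_adjacencyClass K
  exact ⟨mt hasFiniteUHBasis_of_hasFiniteIdentityBasis, Set.infinite_of_injOn_mapsTo hinj hmaps,
    mt fun h => hmaps.countable_of_injOn hinj h⟩
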